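/- Fix an input dimension $M$, an output dimension $L$, a number $D$ of hidden layers, a continuous nonlinearity $\phi:\mathbb R\to\mathbb R$ for which there are constants $c,m\ge 0$ with $|\phi(u)|\le c+m|u|$ for all $u\in\mathbb R$, and constants $\hat C_w^{(\mu)},C_b^{(\mu)}\ge 0$ for $1\le\mu\le D+1$. For each $1\le\mu\le D$ let $h_\mu:\mathbb N\to\mathbb N$ be a strictly increasing width function. For each $n\in\mathbb N$ consider the random fully connected network with hidden layers of widths $H_\mu=h_\mu(n)$, $1\le\mu\le D$, \[ f^{(1)}_i(x)[n]=\sum_{j=1}^{M}w^{(1)}_{i,j}x_j+b^{(1)}_i,\qquad f^{(\mu+1)}_i(x)[n]=\sum_{j=1}^{H_\mu}w^{(\mu+1)}_{i,j}\,\phi\big(f^{(\mu)}_j(x)[n]\big)+b^{(\mu+1)}_i\quad(1\le\mu\le D), \] whose output at the input $x\in\mathbb R^M$ is the vector $(f^{(D+1)}_i(x)[n])_{1\le i\le L}$. All its weights and biases are mutually independent, with $b^{(\mu)}_i\sim\mathcal N(0,C_b^{(\mu)})$, $w^{(1)}_{i,j}\sim\mathcal N(0,\hat C_w^{(1)})$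 and $w^{(\mu)}_{i,j}\sim\mathcal N(0,\hat C_w^{(\mu)}/H_{\mu-1})$ for $2\le\mu\le D+1$. Define kernels on $\mathbb R^M$ recursively by $K^{(1)}(x,x')=\hat C_w^{(1)}\sum_{j=1}^M x_jx'_j+C_b^{(1)}$ and, for $1\le\mu\le D$, \[ K^{(\mu+1)}(x,x')=\hat C_w^{(\mu+1)}\,\mathbb E\big[\phi(\epsilon_1)\phi(\epsilon_2)\big]+C_b^{(\mu+1)},\qquad (\epsilon_1,\epsilon_2)\sim\mathcal N\!\left(0,\begin{pmatrix}K^{(\mu)}(x,x)&K^{(\mu)}(x,x')\\K^{(\mu)}(x',x)&K^{(\mu)}(x',x')\end{pmatrix}\right). \] Then for every sequence of inputs $(x[k])_{k\in\mathbb N}$ in $\mathbb R^M$, as $n\to\infty$ the family of outputs $\big(f^{(D+1)}_i(x[k])[n]\big)_{k\in\mathbb N,\,1\le i\le L}$ converges in distribution, in $\mathbb R^{\mathbb N\times\{1,\dots,L\}}$ with the product topology, to a Gaussian process $(Z_{k,i})$ with mean zero and covariance \[ \operatorname{Cov}(Z_{k,i},Z_{l,j})=\delta_{i,j}\,K^{(D+1)}(x[k],x[l]).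 \] -/

import Mathlib

open MeasureTheory ProbabilityTheory Filter
open scoped NNReal Topology

namespace WideNet

/-- The linear envelope property: `|φ u| ≤ c + m |u|` for some constants `c, m ≥ 0`. -/
def LinearEnvelope (φ : ℝ → ℝ) : Prop :=
  ∃ c m : ℝ, 0 ≤ c ∧ 0 ≤ m ∧ ∀ u : ℝ, |φ u| ≤ c + m * |u|

/-- Widths of the successive layers of the `n`-th network: the input layer (layer `0`) has `M`
units, the hidden layer `μ` (for `1 ≤ μ ≤ D`) has `h μ n` units, and the output layer (layer
`D + 1`) has `L` units. -/
def layerWidth (M L D : ℕ) (h : ℕ → ℕ → ℕ) (n : ℕ) : ℕ → ℕ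
  | 0 => M
  | k + 1 => if k < D then h (k + 1) n else L

theorem layerWidth_output (M L D : ℕ) (h : ℕ → ℕ → ℕ) (n : ℕ) :
    layerWidth M L D h n (D + 1) = L := by
  simp [layerWidth]

/-- The parameters of a fully connected network with `D` hidden layers and layer widths `w`.
`weight k _ i j` is the weight from unit `j` of layer `k` to unit `i` of layer `k + 1`, and
`bias k _ i` is the bias of unit `i` of layer `k + 1`, where `k = 0, …, D`. -/
inductive Param (w : ℕ → ℕ) (D : ℕ) : Type
  | weight (k : ℕ) (hk : k ≤ D) (i : Fin (w (k + 1))) (j : Fin (w k)) : Param w D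
  | bias (k : ℕ) (hk : k ≤ D) (i : Fin (w (k + 1))) : Param w D

/-- The variances of the parameters. `Cw μ` and `Cb μ`, for `1 ≤ μ ≤ D + 1`, are the width-free
variances of the weights and biases that feed into layer `μ`. The weights that feed into layer
`μ ≥ 2` have variance `Cw μ` divided by the width of layer `μ - 1`. -/
noncomputable def paramVar (Cw Cb : ℕ → ℝ≥0) {w : ℕ → ℕ} {D : ℕ} : Param w D → ℝ≥0
  | .weight 0 _ _ _ => Cw 1
  | .weight (k + 1) _ _ _ => Cw (k + 2) / (w (k + 1) : ℝ≥0)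
  | .bias k _ _ => Cb (k + 1)

/-- `activation φ θ x k _ i` is the pre-nonlinearity of unit `i` of layer `k + 1` of the network
with nonlinearity `φ` and parameters `θ`, at the input `x`. -/
noncomputable def activation (φ : ℝ → ℝ) {w : ℕ → ℕ} {D : ℕ} (θ : Param w D → ℝ)
    (x : Fin (w 0) → ℝ) : (k : ℕ) → k ≤ D → Fin (w (k + 1)) → ℝ
  | 0, hk, i => ∑ j : Fin (w 0), θ (.weight 0 hk i j) * x j + θ (.bias 0 hk i)
  | k + 1, hk, i =>
      ∑ j : Fin (w (k + 1)),
        θ (.weight (k + 1) hk i j) * φ (activation φ θ x k (Nat.le_of_succ_le hk) j)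
      + θ (.bias (k + 1) hk i)

/-- The output of the `n`-th network with input dimension `M`, `D` hidden layers of widths
`h 1 n, …, h D n`, and output dimension `L`. -/
noncomputable def output (φ : ℝ → ℝ) {M L D : ℕ} {h : ℕ → ℕ → ℕ} {n : ℕ}
    (θ : Param (layerWidth M L D h n) D → ℝ) (x : Fin M → ℝ) (i : Fin L) : ℝ :=
  activation φ θ x D le_rfl (Fin.cast (layerWidth_output M L D h n).symm i)

/-- The recursive kernel: `kernel φ Cw Cb k` is the limiting covariance function of any one unit
of layer `k + 1`. -/
noncomputable def kernel (φ : ℝ → ℝ) (Cw Cb : ℕ → ℝ≥0) {M : ℕ} :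
    ℕ → (Fin M → ℝ) → (Fin M → ℝ) → ℝ
  | 0, x, x' => Cw 1 * ∑ j, x j * x' j + Cb 1
  | k + 1, x, x' =>
      Cw (k + 2) *
        (∫ ε, φ (ε 0) * φ (ε 1) ∂(multivariateGaussian (0 : EuclideanSpace ℝ (Fin 2))
          !![kernel φ Cw Cb k x x, kernel φ Cw Cb k x x';
             kernel φ Cw Cb k x' x, kernel φ Cw Cb k x' x']))
      + Cb (k + 2)

end WideNet

/-! Given all parameters below layer k + 1, the pre-nonlinearities of that layer are centred
Gaussian: distinct units are independent, and one unit has as covariance an empirical kernel, an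
affine function of the Gram sums of the previous layer's outputs. It therefore suffices that the
empirical kernels converge in probability to the deterministic recursive kernel.

That is an induction on depth (`tendsto_empiricalKernel`). Conditionally, the next Gram average is a
mean of i.i.d. terms whose expectation is a Gaussian integral in the current empirical covariance.
Chebyshev's inequality (`measure_abs_average_sub_le`) controls its fluctuation, and continuity of
the Gaussian integral in the covariance (`continuousOn_integral_multivariateGaussian`) controls its
expectation. The bound only needs the width at hand to be large, so all widths may grow together.
Conditioning is done by resampling one layer of a product measure and applying Fubini.

The characteristic function of finitely many outputs is the expectation of exp(-tᵀŜt/2), with Ŝ the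
empirical covariance (`charFun_activation`), so it converges to its Gaussian value and Lévy's
theorem applies. Tightness of marginals and Prokhorov's theorem extend this to the countable product
(`exists_tendsto_of_tendsto_marginals`). -/

namespace WideNet

/-! ### Continuity of Gaussian integrals in the covariance matrix. -/

section GaussianIntegral

open scoped MatrixOrder

variable {ι : Type*} [Fintype ι]

open scoped Matrix.Norms.L2Operator in
theorem continuousOn_matrix_sqrt [DecidableEq ι] :
    ContinuousOn (fun S : Matrix ι ι ℝ => CFC.sqrt S) {S | S.PosSemidef} := by
  unfold CFC.sqrt
  exact ContinuousOn.cfcₙ_nnreal_of_mem_nhdsSet (A := Matrix ι ι ℝ) (s := Set.univ) NNReal.sqrt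
    Filter.univ_mem continuousOn_id (fun S hS => Matrix.nonneg_iff_posSemidef.2 hS)

open scoped Matrix.Norms.L2Operator in
theorem norm_toEuclideanCLM_le [DecidableEq ι] (A : Matrix ι ι ℝ) (z : EuclideanSpace ℝ ι) :
    ‖Matrix.toEuclideanCLM (𝕜 := ℝ) A z‖ ≤ ‖A‖ * ‖z‖ :=
  A.l2_opNorm_mulVec z

theorem integrable_const_add_mul_norm_pow {E : Type*} [NormedAddCommGroup E] [NormedSpace ℝ E]
    [MeasurableSpace E] [BorelSpace E] [CompleteSpace E] [SecondCountableTopology E]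
    (μ : Measure E) [IsGaussian μ] (a b : ℝ) (p : ℕ) :
    Integrable (fun z => (a + b * ‖z‖) ^ p) μ := by
  rcases eq_or_ne p 0 with rfl | hp
  · simp
  have h : MemLp (fun z : E => a + b * ‖z‖) p μ :=
    (memLp_const a).add (((IsGaussian.memLp_id μ p (by simp)).norm).const_mul b)
  exact (h.integrable_norm_pow hp).mono'
    (by fun_prop) (ae_of_all _ fun z => by simp)

variable {g : EuclideanSpace ℝ ι → ℝ} {a b : ℝ} {p : ℕ}

theorem integrable_of_le_pow (hg : Continuous g) (hb : ∀ y, |g y| ≤ (a + b * ‖y‖) ^ p)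
    (μ : Measure (EuclideanSpace ℝ ι)) [IsGaussian μ] : Integrable g μ :=
  (integrable_const_add_mul_norm_pow μ a b p).mono' hg.aestronglyMeasurable
    (ae_of_all _ fun y => by simpa using hb y)

open scoped Matrix.Norms.L2Operator in
/-- Integrals of continuous functions of polynomial growth against centred Gaussian measures depend
continuously on the covariance matrix. -/
theorem continuousOn_integral_multivariateGaussian [DecidableEq ι] (hg : Continuous g) (ha : 0 ≤ a) (hb0 : 0 ≤ b)
    (hb : ∀ y, |g y| ≤ (a + b * ‖y‖) ^ p) :
    ContinuousOn (fun S : Matrix ι ι ℝ => ∫ y, g y ∂(multivariateGaussian 0 S))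
      {S | S.PosSemidef} := by
  intro S₀ hS₀
  -- Writing the Gaussian as the image of a standard one under the square root of S moves S from the
  -- measure into the integrand, where dominated convergence applies.
  have hrepr : ∀ S : Matrix ι ι ℝ, ∫ y, g y ∂(multivariateGaussian 0 S) =
      ∫ z, g (Matrix.toEuclideanCLM (𝕜 := ℝ) (CFC.sqrt S) z)
        ∂(stdGaussian (EuclideanSpace ℝ ι)) := by
    intro S
    rw [multivariateGaussian, integral_map (by fun_prop) hg.aestronglyMeasurable]
    simp
  simp only [hrepr]
  have hc : Tendsto (fun S : Matrix ι ι ℝ => CFC.sqrt S) (𝓝[{S | S.PosSemidef}] S₀)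
      (𝓝 (CFC.sqrt S₀)) := continuousOn_matrix_sqrt S₀ hS₀
  refine tendsto_integral_filter_of_dominated_convergence
    -- Near S₀ the square root has norm at most ‖√S₀‖ + 1, which makes this dominating function
    -- uniform in S.
    (fun z => (a + b * (‖CFC.sqrt S₀‖ + 1) * ‖z‖) ^ p) ?_ ?_
    (integrable_const_add_mul_norm_pow _ _ _ _) ?_
  · exact Eventually.of_forall fun S => (by fun_prop : Continuous _).aestronglyMeasurable
  · filter_upwards [hc.norm.eventually_le_const (lt_add_one _)] with S hS
    refine ae_of_all _ fun z => (hb _).trans ?_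
    have := norm_toEuclideanCLM_le (CFC.sqrt S) z
    have h2 : ‖CFC.sqrt S‖ * ‖z‖ ≤ (‖CFC.sqrt S₀‖ + 1) * ‖z‖ := by gcongr
    rw [mul_assoc]
    gcongr
    exact this.trans h2
  · refine ae_of_all _ fun z => (hg.tendsto _).comp ?_
    have hlin : Continuous fun A : Matrix ι ι ℝ => Matrix.toEuclideanCLM (𝕜 := ℝ) A z := by
      have : (fun A : Matrix ι ι ℝ => Matrix.toEuclideanCLM (𝕜 := ℝ) A z) =
          fun A => WithLp.toLp 2 (A.mulVec z.ofLp) := by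
        ext A i; simp
      rw [this]
      fun_prop
    exact (hlin.tendsto _).comp hc

end GaussianIntegral

/-! ### Resampling in product measures, and Gaussian vectors. -/

section GaussianVector

/-- Resampling a set of coordinates of a product measure does not change the law. -/
theorem measurePreserving_piecewise {ι : Type*} [Fintype ι] {α : ι → Type*}
    [∀ i, MeasurableSpace (α i)] (μ : ∀ i, Measure (α i)) [∀ i, IsProbabilityMeasure (μ i)]
    (S : Set ι) [DecidablePred (· ∈ S)] :
    MeasurePreserving (fun z : (∀ i, α i) × (∀ i, α i) => S.piecewise z.2 z.1)
      ((Measure.pi μ).prod (Measure.pi μ)) (Measure.pi μ) := by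
  have hm : Measurable (fun z : (∀ i, α i) × (∀ i, α i) => S.piecewise z.2 z.1) := by
    refine measurable_pi_lambda _ fun i => ?_
    by_cases hi : i ∈ S
    · simp only [Set.piecewise_eq_of_mem _ _ _ hi]; fun_prop
    · simp only [Set.piecewise_eq_of_notMem _ _ _ hi]; fun_prop
  refine ⟨hm, (Measure.pi_eq fun s hs => ?_).symm⟩
  rw [Measure.map_apply hm (MeasurableSet.univ_pi hs)]
  -- The preimage of a box is a product of two boxes: coordinates in S constrain only `z.2`, the
  -- others only `z.1`.
  have : (fun z : (∀ i, α i) × (∀ i, α i) => S.piecewise z.2 z.1) ⁻¹' (Set.univ.pi s) =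
      (Set.univ.pi fun i => if i ∈ S then Set.univ else s i) ×ˢ
        (Set.univ.pi fun i => if i ∈ S then s i else Set.univ) := by
    ext z
    simp only [Set.mem_preimage, Set.mem_univ_pi, Set.mem_prod, ← forall_and]
    refine forall_congr' fun i => ?_
    by_cases hi : i ∈ S <;> simp [hi]
  rw [this, Measure.prod_prod, Measure.pi_pi, Measure.pi_pi, ← Finset.prod_mul_distrib]
  refine Finset.prod_congr rfl fun i _ => ?_
  by_cases hi : i ∈ S <;> simp [hi]

variable {Ω : Type*} {mΩ : MeasurableSpace Ω} {P : Measure Ω}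

/-- A centred Gaussian vector is determined by its covariance matrix. -/
theorem hasLaw_multivariateGaussian {κ : Type*} [Fintype κ] [DecidableEq κ] {Y : κ → Ω → ℝ}
    (hY : HasGaussianLaw (fun ω s => Y s ω) P) (hmean : ∀ s, ∫ ω, Y s ω ∂P = 0)
    {S : Matrix κ κ ℝ} (hS : S.PosSemidef) (hcov : ∀ s t, cov[Y s, Y t; P] = S s t) :
    HasLaw (fun ω => WithLp.toLp 2 (fun s => Y s ω)) (multivariateGaussian 0 S) P := by
  have hP := hY.isProbabilityMeasure
  have hmeas : ∀ s, AEMeasurable (Y s) P := fun s => hY.aemeasurable.eval s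
  have hZ : HasGaussianLaw (fun ω => WithLp.toLp 2 (fun s => Y s ω)) P :=
    hY.map (PiLp.continuousLinearEquiv 2 ℝ (fun _ : κ => ℝ)).symm.toContinuousLinearMap
  refine ⟨hZ.aemeasurable, ?_⟩
  have := hZ.isGaussian_map
  refine Measure.ext_of_charFun ?_
  ext t
  rw [charFun_multivariateGaussian hS, hZ.charFun_map_eq]
  have hmem : ∀ s, MemLp (Y s) 2 P := fun s => (hY.eval s).memLp_two
  have hin : ∀ ω, inner ℝ t (WithLp.toLp 2 (fun s => Y s ω)) = ∑ s, t s * Y s ω := by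
    intro ω; simp [PiLp.inner_apply, mul_comm]
  simp only [hin]
  have h0 : ∫ ω, ∑ s, t s * Y s ω ∂P = 0 := by
    rw [integral_finsetSum _ fun s _ => ((hmem s).integrable (by norm_num)).const_mul _]
    simp [integral_const_mul, hmean]
  have h1 : Var[fun ω => ∑ s, t s * Y s ω; P] = t.ofLp ⬝ᵥ S.mulVec t.ofLp := by
    rw [← covariance_self (by fun_prop),
      covariance_fun_sum_fun_sum (fun s => (hmem s).const_mul (t s))
        (fun s => (hmem s).const_mul (t s))]
    simp only [dotProduct, Matrix.mulVec, Finset.mul_sum]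
    refine Finset.sum_congr rfl fun s _ => Finset.sum_congr rfl fun s' _ => ?_
    rw [covariance_const_mul_left, covariance_const_mul_right]
    change t s * (t s' * cov[Y s, Y s'; P]) = _
    rw [hcov]; ring
  rw [h0, h1]
  simp

variable {ι : Type*} [Fintype ι] {X : ι → Ω → ℝ} {v : ι → ℝ≥0}

theorem integral_linearCombination (hX : ∀ i, HasLaw (X i) (gaussianReal 0 (v i)) P) (c : ι → ℝ) :
    ∫ ω, ∑ i, c i * X i ω ∂P = 0 := by
  rw [integral_finsetSum _ fun i _ => ((hX i).hasGaussianLaw.integrable).const_mul _]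
  refine Finset.sum_eq_zero fun i _ => ?_
  rw [integral_const_mul, (hX i).integral_eq, integral_id_gaussianReal, mul_zero]

theorem covariance_linearCombination [IsProbabilityMeasure P] (hind : iIndepFun X P)
    (hX : ∀ i, HasLaw (X i) (gaussianReal 0 (v i)) P) (c d : ι → ℝ) :
    cov[fun ω => ∑ i, c i * X i ω, fun ω => ∑ i, d i * X i ω; P] = ∑ i, v i * (c i * d i) := by
  classical
  have hmem : ∀ i, MemLp (X i) 2 P := fun i => (hX i).hasGaussianLaw.memLp_two
  rw [covariance_fun_sum_fun_sum (fun i => (hmem i).const_mul (c i))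
    (fun i => (hmem i).const_mul (d i))]
  refine Finset.sum_congr rfl fun i _ => ?_
  rw [Finset.sum_eq_single i]
  · rw [covariance_const_mul_left, covariance_const_mul_right]
    rw [covariance_self (hX i).aemeasurable, (hX i).variance_eq, variance_id_gaussianReal]
    ring
  · intro j _ hj
    rw [covariance_const_mul_left, covariance_const_mul_right]
    rw [(hind.indepFun hj.symm).covariance_eq_zero (hmem i) (hmem j)]
    simp
  · simp

theorem hasGaussianLaw_linearCombination (hind : iIndepFun X P)
    (hX : ∀ i, HasLaw (X i) (gaussianReal 0 (v i)) P) {κ : Type*} [Fintype κ] (c : κ → ι → ℝ) :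
    HasGaussianLaw (fun ω s => ∑ i, c s i * X i ω) P := by
  have h := hind.hasGaussianLaw (fun i => (hX i).hasGaussianLaw)
  exact h.map (ContinuousLinearMap.pi fun s =>
    ∑ i, c s i • ContinuousLinearMap.proj (R := ℝ) (φ := fun _ : ι => ℝ) i) |>.congr
      (ae_of_all _ fun ω => by ext s; simp)

end GaussianVector

/-! ### From finite-dimensional marginals to a countable product. -/

section ProjectiveConvergence

open scoped ENNReal

variable {T : Type*} [Countable T]

/-- A family of measures on a countable product is tight if its marginals are. -/
theorem isTightMeasureSet_pi {X : T → Type*} [∀ t, TopologicalSpace (X t)] [∀ t, T2Space (X t)]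
    [∀ t, MeasurableSpace (X t)] [∀ t, OpensMeasurableSpace (X t)] {S : Set (Measure (∀ t, X t))}
    (h : ∀ t, IsTightMeasureSet ((fun μ => μ.map (fun f => f t)) '' S)) :
    IsTightMeasureSet S := by
  rw [isTightMeasureSet_iff_exists_isCompact_measure_compl_le]
  intro ε hε
  -- The budget ε is shared among the coordinates; the product of the resulting compact sets is
  -- compact by Tychonoff.
  obtain ⟨δ, hδ, hsum⟩ := ENNReal.exists_pos_sum_of_countable' hε.ne' T
  have hK : ∀ t, ∃ K : Set (X t), IsCompact K ∧ ∀ μ ∈ S, μ ((fun f => f t) ⁻¹' Kᶜ) ≤ δ t := by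
    intro t
    obtain ⟨K, hK, hK'⟩ :=
      isTightMeasureSet_iff_exists_isCompact_measure_compl_le.1 (h t) (δ t) (hδ t)
    refine ⟨K, hK, fun μ hμ => ?_⟩
    rw [← Measure.map_apply (measurable_pi_apply t) hK.isClosed.measurableSet.compl]
    exact hK' _ ⟨μ, hμ, rfl⟩
  choose K hK hK' using hK
  refine ⟨Set.univ.pi K, isCompact_univ_pi hK, fun μ hμ => ?_⟩
  have : (Set.univ.pi K)ᶜ = ⋃ t, (fun f : ∀ t, X t => f t) ⁻¹' (K t)ᶜ := by
    ext f; simp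
  rw [this]
  exact (measure_iUnion_le _).trans ((ENNReal.tsum_le_tsum fun t => hK' t μ hμ).trans hsum.le)

/-- If all finite-dimensional marginals of a sequence of probability measures on a countable power
of `ℝ` converge weakly, then the sequence converges weakly to a measure with these marginals. -/
theorem exists_tendsto_of_tendsto_marginals (μ : ℕ → ProbabilityMeasure (T → ℝ))
    (ρ : ∀ I : Finset T, ProbabilityMeasure (I → ℝ))
    (h : ∀ I : Finset T, Tendsto (fun n => (μ n).map
      (Finset.measurable_restrict (X := fun _ : T => ℝ) I).aemeasurable) atTop (𝓝 (ρ I))) :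
    ∃ ν : ProbabilityMeasure (T → ℝ),
      (∀ I : Finset T, (ν : Measure (T → ℝ)).map I.restrict = ρ I) ∧ Tendsto μ atTop (𝓝 ν) := by
  have hmarg : ∀ t, IsTightMeasureSet
      ((fun μ => μ.map (fun f => f t)) '' {((m : ProbabilityMeasure (T → ℝ)) : Measure (T → ℝ)) |
        m ∈ Set.range μ}) := by
    intro t
    have hcomp : IsCompact (closure (Set.range fun n => (μ n).map
        (Finset.measurable_restrict (X := fun _ : T => ℝ) {t}).aemeasurable)) :=
      ((h {t}).isCompact_insert_range).closure_of_subset (Set.subset_insert _ _)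
    have ht := (isTightMeasureSet_of_isCompact_closure hcomp).map
      (f := fun x : ({t} : Finset T) → ℝ => x ⟨t, by simp⟩) (by fun_prop)
    refine ht.subset ?_
    rintro _ ⟨_, ⟨_, ⟨n, rfl⟩, rfl⟩, rfl⟩
    refine ⟨_, ⟨_, ⟨n, rfl⟩, rfl⟩, ?_⟩
    simp only [ProbabilityMeasure.toMeasure_map]
    exact Measure.map_map (measurable_pi_apply _) (Finset.measurable_restrict _)
  have hcomp : IsCompact (closure (Set.range μ)) :=
    isCompact_closure_of_isTightMeasureSet (isTightMeasureSet_pi hmarg)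
  -- Compactness gives a limit along every ultrafilter finer than `atTop`, and `h` forces its
  -- marginals to be `ρ`. Since marginals determine the measure, all these limits coincide.
  have hlim : ∀ U : Ultrafilter ℕ, (U : Filter ℕ) ≤ atTop → ∃ ν : ProbabilityMeasure (T → ℝ),
      Tendsto μ U (𝓝 ν) ∧
        ∀ I : Finset T, (ν : Measure (T → ℝ)).map I.restrict = ρ I := by
    intro U hU
    obtain ⟨ν, -, hν⟩ := hcomp.ultrafilter_le_nhds (U.map μ)
      (le_principal_iff.2 (Filter.Eventually.of_forall (f := (U : Filter ℕ))
        fun n => subset_closure (Set.mem_range_self n)))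
    have hν' : Tendsto μ U (𝓝 ν) := hν
    refine ⟨ν, hν', fun I => ?_⟩
    have h1 := ProbabilityMeasure.tendsto_map_of_tendsto_of_continuous _ _ hν'
      (f := I.restrict (π := fun _ : T => ℝ)) (by fun_prop)
    have h2 := tendsto_nhds_unique h1 ((h I).mono_left hU)
    simpa using congrArg (fun m : ProbabilityMeasure (I → ℝ) => (m : Measure (I → ℝ))) h2
  obtain ⟨ν, -, hν⟩ := hlim (hyperfilter ℕ) (Nat.hyperfilter_le_atTop)
  refine ⟨ν, hν, (tendsto_iff_ultrafilter _ _ _).2 fun U hU => ?_⟩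
  obtain ⟨ν', hν', hν'2⟩ := hlim U hU
  have : ν = ν' := by
    apply Subtype.ext
    exact IsProjectiveLimit.unique (α := fun _ : T => ℝ)
      (P := fun I => (ρ I : Measure (I → ℝ))) hν hν'2
  rwa [this]

end ProjectiveConvergence

/-! ### Convergence in probability as a filter, over varying probability spaces. -/

section ConvergenceInProbability

open scoped ENNReal

variable {Ω : ℕ → Type*} [∀ n, MeasurableSpace (Ω n)] (P : ∀ n, Measure (Ω n))

/-- The filter of those sequences of events whose probabilities tend to one. A sequence of random
variables converges in probability to a constant iff it tends to it along this filter. -/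
def inProbability : Filter (Σ n, Ω n) where
  sets := {A | Tendsto (fun n => P n {ω | ⟨n, ω⟩ ∉ A}) atTop (𝓝 0)}
  univ_sets := by simp
  sets_of_superset {A B} hA hAB := by
    refine tendsto_of_tendsto_of_tendsto_of_le_of_le tendsto_const_nhds hA
      (fun _ => bot_le) fun n => measure_mono fun ω hω h => hω (hAB h)
  inter_sets {A B} hA hB := by
    have h := Tendsto.add hA hB
    rw [add_zero] at h
    refine tendsto_of_tendsto_of_tendsto_of_le_of_le tendsto_const_nhds h
      (fun _ => bot_le) fun n => (measure_mono ?_).trans (measure_union_le _ _)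
    intro ω hω
    by_contra hc
    simp only [Set.mem_union, Set.mem_ofPred_eq, not_or, not_not] at hc
    exact hω hc

variable {P}

theorem mem_inProbability {A : Set (Σ n, Ω n)} :
    A ∈ inProbability P ↔ Tendsto (fun n => P n {ω | ⟨n, ω⟩ ∉ A}) atTop (𝓝 0) :=
  Iff.rfl

variable [∀ n, IsProbabilityMeasure (P n)]

/-- Lets closed conditions, such as positive semidefiniteness, pass to limits in probability. -/
instance inProbability_neBot : (inProbability P).NeBot := by
  refine ⟨fun h => ?_⟩
  have : (∅ : Set (Σ n, Ω n)) ∈ inProbability P := h ▸ Filter.mem_bot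
  rw [mem_inProbability] at this
  simp at this

/-- Bounded convergence in probability implies convergence of expectations. -/
theorem tendsto_integral_of_inProbability {X : (Σ n, Ω n) → ℝ} {c C : ℝ}
    (hX : Tendsto X (inProbability P) (𝓝 c)) (hm : ∀ n, AEMeasurable (fun ω => X ⟨n, ω⟩) (P n))
    (hb : ∀ z, |X z - c| ≤ C) :
    Tendsto (fun n => ∫ ω, X ⟨n, ω⟩ ∂(P n)) atTop (𝓝 c) := by
  rw [Metric.tendsto_atTop]
  intro ε hε
  have hC : 0 ≤ C := (abs_nonneg _).trans (hb (Classical.choice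
    (inferInstance : (inProbability P).NeBot).nonempty))
  have hA := mem_inProbability.1 (hX (Metric.ball_mem_nhds c (half_pos hε)))
  have hA' : Tendsto (fun n => (P n).real {ω | ⟨n, ω⟩ ∉ X ⁻¹' Metric.ball c (ε / 2)}) atTop (𝓝 0) :=
    (ENNReal.tendsto_toReal ENNReal.zero_ne_top).comp hA
  have hA2 := hA'.const_mul C
  rw [mul_zero] at hA2
  obtain ⟨N, hN⟩ := eventually_atTop.1 (hA2.eventually (gt_mem_nhds (half_pos hε)))
  refine ⟨N, fun n hn => ?_⟩
  -- The deviation is below ε/2 off an event of vanishing probability and at most C on it.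
  have hbi : ∀ ω, |X ⟨n, ω⟩ - c| ≤
      ε / 2 + {ω | ⟨n, ω⟩ ∉ X ⁻¹' Metric.ball c (ε / 2)}.indicator (fun _ => C) ω := by
    intro ω
    by_cases hω : X ⟨n, ω⟩ ∈ Metric.ball c (ε / 2)
    · rw [Set.indicator_of_notMem (by simpa using hω), add_zero]
      exact (by simpa [Real.dist_eq] using hω : |X ⟨n, ω⟩ - c| < ε / 2).le
    · rw [Set.indicator_of_mem (by simpa using hω)]
      linarith [hb ⟨n, ω⟩]
  have hint : Integrable (fun ω => X ⟨n, ω⟩ - c) (P n) :=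
    Integrable.of_bound ((hm n).sub_const c).aestronglyMeasurable C
      (ae_of_all _ fun ω => hb _)
  have hns : NullMeasurableSet {ω | ⟨n, ω⟩ ∉ X ⁻¹' Metric.ball c (ε / 2)} (P n) :=
    (hm n).nullMeasurableSet_preimage (Metric.isOpen_ball.measurableSet).compl
  have hint' : Integrable (fun ω => X ⟨n, ω⟩) (P n) := by
    exact (hint.add (integrable_const c)).congr (ae_of_all _ fun ω => by simp)
  have heq : ∫ ω, X ⟨n, ω⟩ ∂(P n) - c = ∫ ω, (X ⟨n, ω⟩ - c) ∂(P n) := by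
    rw [integral_sub hint' (integrable_const c)]; simp
  rw [Real.dist_eq, heq]
  calc |∫ ω, (X ⟨n, ω⟩ - c) ∂(P n)| ≤ ∫ ω, |X ⟨n, ω⟩ - c| ∂(P n) := abs_integral_le_integral_abs
    _ ≤ ∫ ω, (ε / 2 + {ω | ⟨n, ω⟩ ∉ X ⁻¹' Metric.ball c (ε / 2)}.indicator (fun _ => C) ω)
        ∂(P n) := by
        refine integral_mono hint.abs ?_ hbi
        exact (integrable_const _).add ((integrable_const C).indicator₀ hns)
    _ = ε / 2 + C * (P n).real {ω | ⟨n, ω⟩ ∉ X ⁻¹' Metric.ball c (ε / 2)} := by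
        rw [integral_add (integrable_const _) ((integrable_const C).indicator₀ hns),
          integral_indicator₀ hns]
        simp [mul_comm]
    _ < ε := by linarith [hN n hn]

end ConvergenceInProbability

/-- The quadratic form of S at t is the variance of the combination of the `Y s` with coefficients
t. -/
theorem posSemidef_of_covariance {Ω : Type*} {mΩ : MeasurableSpace Ω} {P : Measure Ω}
    [IsProbabilityMeasure P] {κ : Type*} [Fintype κ] {Y : κ → Ω → ℝ} (hY : ∀ s, MemLp (Y s) 2 P)
    {S : Matrix κ κ ℝ} (hcov : ∀ s t, cov[Y s, Y t; P] = S s t) : S.PosSemidef := by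
  refine Matrix.PosSemidef.of_dotProduct_mulVec_nonneg ?_ fun t => ?_
  · ext s s'
    simp only [Matrix.conjTranspose_apply, star_trivial]
    rw [← hcov, ← hcov, covariance_comm]
  · have h1 : Var[fun ω => ∑ s, t s * Y s ω; P] = star t ⬝ᵥ S.mulVec t := by
      rw [← covariance_self (Finset.aemeasurable_fun_sum _
          fun s _ => (hY s).aestronglyMeasurable.aemeasurable.const_mul _),
        covariance_fun_sum_fun_sum (fun s => (hY s).const_mul (t s))
          (fun s => (hY s).const_mul (t s))]
      simp only [dotProduct, Matrix.mulVec, Finset.mul_sum]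
      refine Finset.sum_congr rfl fun s _ => Finset.sum_congr rfl fun s' _ => ?_
      rw [covariance_const_mul_left, covariance_const_mul_right, hcov]
      simp only [star_trivial]
      ring
    rw [← h1]
    exact variance_nonneg _ _

/-! ### One layer with frozen inputs: an exactly Gaussian vector. -/

section Layer

variable {w : ℕ → ℕ} {D : ℕ}

/-- The layer whose units a parameter reads from. -/
def Param.layer : Param w D → ℕ
  | .weight k _ _ _ => k
  | .bias k _ _ => k

/-- The parameters that feed into one unit of layer `k + 1`: its weights and its bias. -/
def unitParam (k : ℕ) (hk : k ≤ D) (e : Fin (w (k + 1)) × Option (Fin (w k))) : Param w D :=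
  e.2.elim (.bias k hk e.1) (.weight k hk e.1)

theorem unitParam_injective (k : ℕ) (hk : k ≤ D) :
    Function.Injective (unitParam (w := w) k hk) := by
  rintro ⟨i, _ | j⟩ ⟨i', _ | j'⟩ h <;> simp_all [unitParam]

instance : Finite (Param w D) := by
  refine Finite.of_surjective
    (fun z : Σ k : Fin (D + 1), Fin (w (k + 1)) × Option (Fin (w k)) =>
      unitParam z.1 (Nat.le_of_lt_succ z.1.2) z.2) ?_
  rintro (⟨k, hk, i, j⟩ | ⟨k, hk, i⟩)
  · exact ⟨⟨⟨k, Nat.lt_succ_of_le hk⟩, i, some j⟩, rfl⟩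
  · exact ⟨⟨⟨k, Nat.lt_succ_of_le hk⟩, i, none⟩, rfl⟩

noncomputable instance : Fintype (Param w D) := Fintype.ofFinite _

/-- The common variance of the weights that read from layer `k`. -/
noncomputable def weightVar (Cw : ℕ → ℝ≥0) (w : ℕ → ℕ) : ℕ → ℝ≥0
  | 0 => Cw 1
  | k + 1 => Cw (k + 2) / (w (k + 1) : ℝ≥0)

theorem paramVar_weight (Cw Cb : ℕ → ℝ≥0) (k : ℕ) (hk : k ≤ D) (i : Fin (w (k + 1)))
    (j : Fin (w k)) : paramVar Cw Cb (.weight k hk i j : Param w D) = weightVar Cw w k := by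
  cases k <;> rfl

theorem paramVar_bias (Cw Cb : ℕ → ℝ≥0) (k : ℕ) (hk : k ≤ D) (i : Fin (w (k + 1))) :
    paramVar Cw Cb (.bias k hk i : Param w D) = Cb (k + 1) := by
  cases k <;> rfl

/-- The joint law of the parameters. -/
noncomputable def paramMeasure (Cw Cb : ℕ → ℝ≥0) (w : ℕ → ℕ) (D : ℕ) :
    Measure (Param w D → ℝ) :=
  Measure.pi fun p => gaussianReal 0 (paramVar Cw Cb p)

instance (Cw Cb : ℕ → ℝ≥0) : IsProbabilityMeasure (paramMeasure Cw Cb w D) := by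
  unfold paramMeasure; infer_instance

/-- The pre-nonlinearity of unit `i` of layer `k + 1`, as a function of the outputs `f` of the units
of layer `k`. -/
def preactivation (k : ℕ) (hk : k ≤ D) (θ : Param w D → ℝ) (f : Fin (w k) → ℝ)
    (i : Fin (w (k + 1))) : ℝ :=
  ∑ j, θ (.weight k hk i j) * f j + θ (.bias k hk i)

/-- The covariance of one unit of layer `k + 1` at two given outputs of layer `k`. -/
noncomputable def gram (Cw Cb : ℕ → ℝ≥0) (w : ℕ → ℕ) (k : ℕ) (f f' : Fin (w k) → ℝ) : ℝ :=
  weightVar Cw w k * ∑ j, f j * f' j + Cb (k + 1)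

variable (Cw Cb : ℕ → ℝ≥0) (k : ℕ) (hk : k ≤ D)

theorem iIndepFun_unitParam :
    iIndepFun (fun e (θ : Param w D → ℝ) => θ (unitParam k hk e)) (paramMeasure Cw Cb w D) :=
  (iIndepFun_pi (μ := fun p : Param w D => gaussianReal 0 (paramVar Cw Cb p))
    (X := fun _ => id) (fun _ => aemeasurable_id)).precomp (unitParam_injective k hk)

theorem hasLaw_param (p : Param w D) :
    HasLaw (fun θ : Param w D → ℝ => θ p) (gaussianReal 0 (paramVar Cw Cb p))
      (paramMeasure Cw Cb w D) :=
  (measurePreserving_eval (fun p : Param w D => gaussianReal 0 (paramVar Cw Cb p)) p).hasLaw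

/-- The coefficients of the pre-nonlinearity of unit `i` as a linear form in the parameters. -/
def unitCoeff {k : ℕ} (f : Fin (w k) → ℝ) (i : Fin (w (k + 1)))
    (e : Fin (w (k + 1)) × Option (Fin (w k))) : ℝ :=
  if e.1 = i then e.2.elim 1 f else 0

/-- Summing over the parameters of all units of the layer, with zero coefficients off unit `i`,
makes different units linear forms in one independent family, hence jointly Gaussian. -/
theorem preactivation_eq_sum (θ : Param w D → ℝ) (f : Fin (w k) → ℝ) (i : Fin (w (k + 1))) :
    preactivation k hk θ f i = ∑ e, unitCoeff f i e * θ (unitParam k hk e) := by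
  simp [preactivation, unitCoeff, unitParam, Fintype.sum_prod_type, Fintype.sum_option,
    add_comm, mul_comm]

variable {κ : Type*} (i : κ → Fin (w (k + 1))) (f : κ → Fin (w k) → ℝ)

theorem hasGaussianLaw_preactivation [Fintype κ] :
    HasGaussianLaw (fun θ s => preactivation k hk θ (f s) (i s)) (paramMeasure Cw Cb w D) := by
  simp only [preactivation_eq_sum]
  exact hasGaussianLaw_linearCombination (iIndepFun_unitParam Cw Cb k hk)
    (fun e => hasLaw_param Cw Cb _) (fun s => unitCoeff (f s) (i s))

theorem integral_preactivation (i : Fin (w (k + 1))) (f : Fin (w k) → ℝ) :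
    ∫ θ, preactivation k hk θ f i ∂(paramMeasure Cw Cb w D) = 0 := by
  simp only [preactivation_eq_sum]
  exact integral_linearCombination (fun e => hasLaw_param Cw Cb _) _

/-- Distinct units share no parameter; within one unit only the diagonal terms of the independent
parameters survive. -/
theorem covariance_preactivation (i i' : Fin (w (k + 1))) (f f' : Fin (w k) → ℝ) :
    cov[fun θ => preactivation k hk θ f i, fun θ => preactivation k hk θ f' i';
      paramMeasure Cw Cb w D] = if i = i' then gram Cw Cb w k f f' else 0 := by
  simp only [preactivation_eq_sum]
  rw [covariance_linearCombination (iIndepFun_unitParam Cw Cb k hk)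
    (fun e => hasLaw_param Cw Cb _)]
  simp only [Fintype.sum_prod_type, Fintype.sum_option, unitParam, unitCoeff, Option.elim,
    paramVar_weight, paramVar_bias]
  rw [Finset.sum_eq_single i]
  · by_cases h : i = i' <;> simp [h, gram, Finset.mul_sum, add_comm]
  · intro j _ hj
    simp [hj]
  · simp

theorem memLp_preactivation (i : Fin (w (k + 1))) (f : Fin (w k) → ℝ) :
    MemLp (fun θ => preactivation k hk θ f i) 2 (paramMeasure Cw Cb w D) :=
  ((hasGaussianLaw_preactivation Cw Cb k hk (fun _ : Unit => i) (fun _ => f)).eval ()).memLp_two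

theorem posSemidef_gram [Fintype κ] (hk : k ≤ D) :
    (Matrix.of fun s t => if i s = i t then gram Cw Cb w k (f s) (f t) else 0).PosSemidef :=
  posSemidef_of_covariance (P := paramMeasure Cw Cb w D)
    (Y := fun s θ => preactivation k hk θ (f s) (i s))
    (fun _ => memLp_preactivation Cw Cb k hk _ _)
    (fun _ _ => covariance_preactivation Cw Cb k hk _ _ _ _)

theorem hasLaw_preactivation [Fintype κ] [DecidableEq κ] :
    HasLaw (fun θ => WithLp.toLp 2 fun s => preactivation k hk θ (f s) (i s))
      (multivariateGaussian 0
        (Matrix.of fun s t => if i s = i t then gram Cw Cb w k (f s) (f t) else 0))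
      (paramMeasure Cw Cb w D) :=
  hasLaw_multivariateGaussian (Y := fun s θ => preactivation k hk θ (f s) (i s))
    (hasGaussianLaw_preactivation Cw Cb k hk i f)
    (fun _ => integral_preactivation Cw Cb k hk _ _) (posSemidef_gram Cw Cb k i f hk)
    (fun _ _ => covariance_preactivation Cw Cb k hk _ _ _ _)

/-- The covariance matrix of one unit of layer `k + 1` at two given outputs of layer `k`. -/
noncomputable def gramMatrix (f f' : Fin (w k) → ℝ) : Matrix (Fin 2) (Fin 2) ℝ :=
  !![gram Cw Cb w k f f, gram Cw Cb w k f f'; gram Cw Cb w k f' f, gram Cw Cb w k f' f']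

theorem hasLaw_preactivation_pair (i : Fin (w (k + 1))) (f f' : Fin (w k) → ℝ) :
    HasLaw (fun θ => !₂[preactivation k hk θ f i, preactivation k hk θ f' i])
      (multivariateGaussian 0 (gramMatrix Cw Cb k f f')) (paramMeasure Cw Cb w D) := by
  have h := hasLaw_preactivation Cw Cb k hk (fun _ : Fin 2 => i) ![f, f']
  have h1 : (Matrix.of fun s t : Fin 2 => if i = i then
      gram Cw Cb w k (![f, f'] s) (![f, f'] t) else 0) = gramMatrix Cw Cb k f f' := by
    ext s t; fin_cases s <;> fin_cases t <;> simp [gramMatrix]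
  rw [h1] at h
  refine h.congr (ae_of_all _ fun θ => ?_)
  ext s; fin_cases s <;> simp

/-- Jointly Gaussian and uncorrelated across units, hence independent. Both inputs are kept together
because the law of large numbers concerns products of activations at two inputs. -/
theorem iIndepFun_preactivation_pair (f f' : Fin (w k) → ℝ) :
    iIndepFun (fun i (θ : Param w D → ℝ) (s : Fin 2) => preactivation k hk θ (![f, f'] s) i)
      (paramMeasure Cw Cb w D) := by
  refine HasGaussianLaw.iIndepFun_of_covariance_eval
    (X := fun i (s : Fin 2) (θ : Param w D → ℝ) => preactivation k hk θ (![f, f'] s) i) ?_ ?_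
  · have h := hasGaussianLaw_preactivation Cw Cb k hk
      (fun z : Fin (w (k + 1)) × Fin 2 => z.1) (fun z => ![f, f'] z.2)
    exact h.map (ContinuousLinearMap.pi fun i => ContinuousLinearMap.pi fun s =>
      ContinuousLinearMap.proj (R := ℝ) (φ := fun _ : Fin (w (k + 1)) × Fin 2 => ℝ) (i, s))
  · intro i j hij s t
    rw [covariance_preactivation, if_neg hij]

end Layer

/-! ### Conditional law of large numbers for the Gram averages. -/

section LawOfLargeNumbers

/-- The Gaussian integral that defines the recursive kernel. -/
noncomputable def dualActivation (φ : ℝ → ℝ) (S : Matrix (Fin 2) (Fin 2) ℝ) : ℝ :=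
  ∫ ε, φ (ε 0) * φ (ε 1) ∂(multivariateGaussian (0 : EuclideanSpace ℝ (Fin 2)) S)

/-- The second moment of the integrand in `dualActivation`. -/
noncomputable def dualActivationSq (φ : ℝ → ℝ) (S : Matrix (Fin 2) (Fin 2) ℝ) : ℝ :=
  ∫ ε, (φ (ε 0) * φ (ε 1)) ^ 2 ∂(multivariateGaussian (0 : EuclideanSpace ℝ (Fin 2)) S)

variable {φ : ℝ → ℝ}

theorem abs_mul_le_of_envelope {c m : ℝ} (hm : 0 ≤ m)
    (h : ∀ u, |φ u| ≤ c + m * |u|) (y : EuclideanSpace ℝ (Fin 2)) :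
    |φ (y 0) * φ (y 1)| ≤ (c + m * ‖y‖) ^ 2 := by
  have hi : ∀ i, |φ (y i)| ≤ c + m * ‖y‖ := fun i =>
    (h _).trans (by gcongr; exact PiLp.norm_apply_le y i)
  rw [abs_mul, sq]
  exact mul_le_mul (hi 0) (hi 1) (abs_nonneg _) ((abs_nonneg _).trans (hi 0))

theorem abs_mul_sq_le_of_envelope {c m : ℝ} (hm : 0 ≤ m)
    (h : ∀ u, |φ u| ≤ c + m * |u|) (y : EuclideanSpace ℝ (Fin 2)) :
    |(φ (y 0) * φ (y 1)) ^ 2| ≤ (c + m * ‖y‖) ^ 4 := by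
  have := pow_le_pow_left₀ (abs_nonneg _) (abs_mul_le_of_envelope hm h y) 2
  rw [abs_pow]
  calc _ ≤ _ := this
    _ = _ := by ring

theorem continuousOn_dualActivation (hφ : Continuous φ) (hlin : LinearEnvelope φ) :
    ContinuousOn (dualActivation φ) {S | S.PosSemidef} := by
  obtain ⟨c, m, hc, hm, h⟩ := hlin
  exact continuousOn_integral_multivariateGaussian (by fun_prop) hc hm
    (abs_mul_le_of_envelope hm h)

theorem continuousOn_dualActivationSq (hφ : Continuous φ) (hlin : LinearEnvelope φ) :
    ContinuousOn (dualActivationSq φ) {S | S.PosSemidef} := by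
  obtain ⟨c, m, hc, hm, h⟩ := hlin
  exact continuousOn_integral_multivariateGaussian (by fun_prop) hc hm
    (abs_mul_sq_le_of_envelope hm h)

variable {w : ℕ → ℕ} {D : ℕ} (Cw Cb : ℕ → ℝ≥0) (k : ℕ) (hk : k ≤ D) (f f' : Fin (w k) → ℝ)

theorem integral_activation_mul (hφ : Continuous φ) (i : Fin (w (k + 1))) :
    ∫ θ, φ (preactivation k hk θ f i) * φ (preactivation k hk θ f' i)
      ∂(paramMeasure Cw Cb w D) = dualActivation φ (gramMatrix Cw Cb k f f') := by
  rw [dualActivation, ← (hasLaw_preactivation_pair Cw Cb k hk i f f').integral_comp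
    (by fun_prop : Continuous fun ε : EuclideanSpace ℝ (Fin 2) =>
      φ (ε 0) * φ (ε 1)).aestronglyMeasurable]
  simp

theorem integral_activation_mul_sq (hφ : Continuous φ) (i : Fin (w (k + 1))) :
    ∫ θ, (φ (preactivation k hk θ f i) * φ (preactivation k hk θ f' i)) ^ 2
      ∂(paramMeasure Cw Cb w D) = dualActivationSq φ (gramMatrix Cw Cb k f f') := by
  rw [dualActivationSq, ← (hasLaw_preactivation_pair Cw Cb k hk i f f').integral_comp
    (by fun_prop : Continuous fun ε : EuclideanSpace ℝ (Fin 2) =>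
      (φ (ε 0) * φ (ε 1)) ^ 2).aestronglyMeasurable]
  simp

theorem memLp_activation_mul (hφ : Continuous φ) (hlin : LinearEnvelope φ)
    (i : Fin (w (k + 1))) :
    MemLp (fun θ => φ (preactivation k hk θ f i) * φ (preactivation k hk θ f' i)) 2
      (paramMeasure Cw Cb w D) := by
  obtain ⟨c, m, hc, hm, h⟩ := hlin
  have hlaw := hasLaw_preactivation_pair Cw Cb k hk i f f'
  have hg : Continuous fun ε : EuclideanSpace ℝ (Fin 2) => φ (ε 0) * φ (ε 1) := by fun_prop
  have hL : MemLp (fun ε : EuclideanSpace ℝ (Fin 2) => φ (ε 0) * φ (ε 1)) 2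
      (multivariateGaussian 0 (gramMatrix Cw Cb k f f')) :=
    (memLp_two_iff_integrable_sq hg.aestronglyMeasurable).2
      (integrable_of_le_pow (by fun_prop) (abs_mul_sq_le_of_envelope hm h) _)
  rw [← hlaw.map_eq] at hL
  have := hL.comp_of_map hlaw.aemeasurable
  exact this.ae_eq (ae_of_all _ fun θ => by simp)

/-- Chebyshev's inequality for the empirical covariance of the outputs of a layer, given the outputs
of the layer below. -/
theorem measure_abs_average_sub_le (hφ : Continuous φ) (hlin : LinearEnvelope φ)
    (hw : 0 < w (k + 1)) {V ε : ℝ} (hV : dualActivationSq φ (gramMatrix Cw Cb k f f') ≤ V)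
    (hε : 0 < ε) :
    paramMeasure Cw Cb w D {θ | ε ≤ |(w (k + 1) : ℝ)⁻¹ *
        ∑ i, φ (preactivation k hk θ f i) * φ (preactivation k hk θ f' i) -
          dualActivation φ (gramMatrix Cw Cb k f f')|} ≤
      ENNReal.ofReal (V / (w (k + 1) * ε ^ 2)) := by
  set P := paramMeasure Cw Cb w D
  set U : Fin (w (k + 1)) → (Param w D → ℝ) → ℝ := fun i θ =>
    φ (preactivation k hk θ f i) * φ (preactivation k hk θ f' i) with hU
  have hw' : (0 : ℝ) < w (k + 1) := by exact_mod_cast hw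
  have hmem : ∀ i, MemLp (U i) 2 P := fun i =>
    memLp_activation_mul Cw Cb k hk f f' hφ hlin i
  have hind : iIndepFun U P := by
    have := (iIndepFun_preactivation_pair Cw Cb k hk f f').comp
      (fun _ (y : Fin 2 → ℝ) => φ (y 0) * φ (y 1)) (fun _ => by fun_prop)
    exact this
  -- A variance is at most the second moment, which is the Gaussian integral bounded by `hV`.
  have hvar : ∀ i, Var[U i; P] ≤ V := fun i => by
    refine (variance_le_expectation_sq (hmem i).aestronglyMeasurable).trans (le_trans ?_ hV)
    exact (integral_activation_mul_sq Cw Cb k hk f f' hφ i).le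
  have hsum : Var[∑ i, U i; P] ≤ w (k + 1) * V := by
    rw [IndepFun.variance_sum (fun i _ => hmem i) (fun i _ j _ hij => hind.indepFun hij)]
    exact (Finset.sum_le_sum fun i _ => hvar i).trans (by simp)
  have hA : MemLp (fun θ => (w (k + 1) : ℝ)⁻¹ * ∑ i, U i θ) 2 P :=
    (memLp_finsetSum _ fun i _ => hmem i).const_mul _
  have hmean : ∫ θ, (w (k + 1) : ℝ)⁻¹ * ∑ i, U i θ ∂P =
      dualActivation φ (gramMatrix Cw Cb k f f') := by
    rw [integral_const_mul, integral_finsetSum _ fun i _ => (hmem i).integrable (by norm_num)]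
    simp only [hU, P, integral_activation_mul Cw Cb k hk f f' hφ]
    simp [hw'.ne']
  have hcheb := meas_ge_le_variance_div_sq hA hε
  rw [hmean] at hcheb
  refine hcheb.trans (ENNReal.ofReal_le_ofReal ?_)
  have hvA : Var[fun θ => (w (k + 1) : ℝ)⁻¹ * ∑ i, U i θ; P] ≤ V / w (k + 1) := by
    rw [variance_const_mul]
    have h1 : Var[fun θ => ∑ i, U i θ; P] ≤ w (k + 1) * V := by
      convert hsum using 2
      ext θ; simp
    calc _ ≤ ((w (k + 1) : ℝ)⁻¹) ^ 2 * (w (k + 1) * V) := by gcongr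
      _ = V / w (k + 1) := by field_simp
  calc _ ≤ V / w (k + 1) / ε ^ 2 := by gcongr
    _ = _ := by rw [div_div]

end LawOfLargeNumbers

/-! ### Layer outputs and their dependence on the parameters. -/

section Network

variable {φ : ℝ → ℝ} {w : ℕ → ℕ} {D : ℕ}

/-- The output of unit `j` of layer `k`, for `k = 0, …, D`, as seen by layer `k + 1`. -/
noncomputable def feature (φ : ℝ → ℝ) (θ : Param w D → ℝ) (x : Fin (w 0) → ℝ) :
    (k : ℕ) → k ≤ D → Fin (w k) → ℝ
  | 0, _ => x
  | k + 1, hk => fun j => φ (activation φ θ x k (Nat.le_of_succ_le hk) j)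

theorem activation_eq_preactivation (θ : Param w D → ℝ) (x : Fin (w 0) → ℝ) (k : ℕ) (hk : k ≤ D)
    (i : Fin (w (k + 1))) :
    activation φ θ x k hk i = preactivation k hk θ (feature φ θ x k hk) i := by
  cases k <;> rfl

theorem feature_succ (θ : Param w D → ℝ) (x : Fin (w 0) → ℝ) (k : ℕ) (hk : k + 1 ≤ D)
    (j : Fin (w (k + 1))) :
    feature φ θ x (k + 1) hk j =
      φ (preactivation k (Nat.le_of_succ_le hk) θ (feature φ θ x k (Nat.le_of_succ_le hk)) j) :=
  congrArg φ (activation_eq_preactivation θ x k (Nat.le_of_succ_le hk) j)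

/-- Layer outputs use only parameters from strictly lower layers; this is why resampling the
parameters of layer `k` acts as conditioning on the layers below. -/
theorem feature_congr {θ η : Param w D → ℝ} (x : Fin (w 0) → ℝ) (k : ℕ) (hk : k ≤ D)
    (h : ∀ p, p.layer < k → θ p = η p) : feature φ θ x k hk = feature φ η x k hk := by
  induction k with
  | zero => rfl
  | succ k ih =>
    ext j
    rw [feature_succ, feature_succ, ih (Nat.le_of_succ_le hk) fun p hp => h p (hp.trans (Nat.lt_succ_self k))]
    simp only [preactivation]
    rw [h (.bias k (Nat.le_of_succ_le hk) j) (Nat.lt_succ_self k)]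
    congr 2
    refine Finset.sum_congr rfl fun j' _ => ?_
    rw [h (.weight k (Nat.le_of_succ_le hk) j j') (Nat.lt_succ_self k)]

theorem measurable_feature (hφ : Continuous φ) (x : Fin (w 0) → ℝ) (k : ℕ) (hk : k ≤ D) :
    Measurable fun θ : Param w D → ℝ => feature φ θ x k hk := by
  induction k with
  | zero => exact measurable_const
  | succ k ih =>
    refine measurable_pi_lambda _ fun j => ?_
    simp only [feature_succ, preactivation]
    have := fun j' => (measurable_pi_apply j').comp (ih (Nat.le_of_succ_le hk))
    refine hφ.measurable.comp (Measurable.add (Finset.measurable_fun_sum _ fun j' _ => ?_)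
      (measurable_pi_apply _))
    exact (measurable_pi_apply _).mul (this j')

theorem measurable_activation (hφ : Continuous φ) (x : Fin (w 0) → ℝ) (k : ℕ) (hk : k ≤ D)
    (i : Fin (w (k + 1))) : Measurable fun θ : Param w D → ℝ => activation φ θ x k hk i := by
  simp only [activation_eq_preactivation, preactivation]
  have := fun j' => (measurable_pi_apply j').comp (measurable_feature (D := D) hφ x k hk)
  refine Measurable.add (Finset.measurable_fun_sum _ fun j' _ => ?_) (measurable_pi_apply _)
  exact (measurable_pi_apply _).mul (this j')

/-- The parameters that feed into layer `k + 1`. -/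
def layerParams (w : ℕ → ℕ) (D k : ℕ) : Set (Param w D) := {p | p.layer = k}

open scoped Classical in
theorem feature_piecewise (θ η : Param w D → ℝ) (x : Fin (w 0) → ℝ) (k : ℕ) (hk : k ≤ D) :
    feature φ ((layerParams w D k).piecewise θ η) x k hk = feature φ η x k hk :=
  feature_congr x k hk fun _ hp => Set.piecewise_eq_of_notMem _ _ _ hp.ne

open scoped Classical in
theorem preactivation_piecewise (θ η : Param w D → ℝ) (k : ℕ) (hk : k ≤ D) (f : Fin (w k) → ℝ)
    (i : Fin (w (k + 1))) :
    preactivation k hk ((layerParams w D k).piecewise θ η) f i = preactivation k hk θ f i := by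
  have h1 : ∀ j, (Param.weight k hk i j : Param w D) ∈ layerParams w D k := fun j => rfl
  have h2 : (Param.bias k hk i : Param w D) ∈ layerParams w D k := rfl
  simp only [preactivation, Set.piecewise_eq_of_mem _ _ _ h2, Set.piecewise_eq_of_mem _ _ _ (h1 _)]

/-- The random covariance of a unit of layer `k + 1` given the layers below. -/
noncomputable def empiricalKernel (φ : ℝ → ℝ) (Cw Cb : ℕ → ℝ≥0) (k : ℕ) (hk : k ≤ D)
    (x x' : Fin (w 0) → ℝ) (θ : Param w D → ℝ) : ℝ :=
  gram Cw Cb w k (feature φ θ x k hk) (feature φ θ x' k hk)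

theorem measurable_empiricalKernel (hφ : Continuous φ) (Cw Cb : ℕ → ℝ≥0) (k : ℕ) (hk : k ≤ D)
    (x x' : Fin (w 0) → ℝ) :
    Measurable (empiricalKernel (D := D) φ Cw Cb k hk x x') := by
  unfold empiricalKernel gram
  have h := fun (x : Fin (w 0) → ℝ) j' =>
    (measurable_pi_apply j').comp (measurable_feature (D := D) hφ x k hk)
  refine Measurable.add_const (Measurable.const_mul (Finset.measurable_fun_sum _ fun j _ => ?_) _) _
  exact (h x j).mul (h x' j)

end Network

theorem isClosed_posSemidef {κ : Type*} [Fintype κ] :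
    IsClosed {S : Matrix κ κ ℝ | S.PosSemidef} := by
  simp only [Matrix.posSemidef_iff_dotProduct_mulVec, Matrix.IsHermitian, Set.ofPred_and,
    Set.ofPred_forall]
  refine IsClosed.inter (isClosed_eq (by fun_prop) (by fun_prop)) (isClosed_iInter fun x => ?_)
  exact isClosed_le (by fun_prop) (by fun_prop)

instance {m n : Type*} : MeasurableSpace (Matrix m n ℝ) :=
  inferInstanceAs (MeasurableSpace (m → n → ℝ))

instance {m n : Type*} [Finite m] [Finite n] : BorelSpace (Matrix m n ℝ) :=
  inferInstanceAs (BorelSpace (m → n → ℝ))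

theorem measurable_matrix {α m n : Type*} [MeasurableSpace α] {S : α → Matrix m n ℝ}
    (h : ∀ i j, Measurable fun a => S a i j) : Measurable S :=
  measurable_pi_lambda _ fun i => measurable_pi_lambda _ fun j => h i j

/-! ### Conditioning on the lower layers by resampling one layer. -/

section Resampling

variable {φ : ℝ → ℝ} {w : ℕ → ℕ} {D : ℕ} {Cw Cb : ℕ → ℝ≥0}

open scoped Classical in
/-- A bound on the conditional probability of an event, given the parameters outside `S`, is a bound
on its probability. -/
theorem paramMeasure_le_of_resample (S : Set (Param w D)) {A : Set (Param w D → ℝ)}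
    (hA : MeasurableSet A) {r : ENNReal}
    (h : ∀ η, paramMeasure Cw Cb w D {θ | S.piecewise θ η ∈ A} ≤ r) :
    paramMeasure Cw Cb w D A ≤ r := by
  have hmp := measurePreserving_piecewise
    (fun p : Param w D => gaussianReal 0 (paramVar Cw Cb p)) S
  have hA' := hmp.measurable hA
  have h2 := hmp.measure_preimage hA.nullMeasurableSet
  rw [Measure.prod_apply hA'] at h2
  rw [paramMeasure, ← h2]
  refine (lintegral_mono fun η => h η).trans ?_
  simp

/-- The matrix is realised as the covariance of a unit of layer `k + 1`, so such a unit must exist: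
hence `hw`. -/
theorem posSemidef_gramMatrix (k : ℕ) (hk : k ≤ D) (hw : 0 < w (k + 1))
    (f f' : Fin (w k) → ℝ) : (gramMatrix Cw Cb k f f').PosSemidef := by
  have h := posSemidef_gram (D := D) Cw Cb k (fun _ : Fin 2 => ⟨0, hw⟩) ![f, f'] hk
  convert h using 1
  ext s t; fin_cases s <;> fin_cases t <;> simp [gramMatrix]

/-- Given the lower layers, the event is either empty or has its Gram matrix in `U`. In the second
case the conditional mean is within ε/2 of `c`, so the average must deviate from that mean by at
least ε/2, and Chebyshev's inequality applies. -/
theorem measure_average_of_near_le (hφ : Continuous φ) (hlin : LinearEnvelope φ) (k : ℕ)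
    (hk : k ≤ D) (hw : 0 < w (k + 1)) (x x' : Fin (w 0) → ℝ) {U : Set (Matrix (Fin 2) (Fin 2) ℝ)}
    (hU : IsOpen U) {c V ε : ℝ} (hε : 0 < ε)
    (h : ∀ S ∈ U, S.PosSemidef → |dualActivation φ S - c| < ε / 2 ∧ dualActivationSq φ S ≤ V) :
    paramMeasure Cw Cb w D {θ |
        gramMatrix Cw Cb k (feature φ θ x k hk) (feature φ θ x' k hk) ∈ U ∧
        ε ≤ |(w (k + 1) : ℝ)⁻¹ * ∑ i, φ (preactivation k hk θ (feature φ θ x k hk) i) *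
          φ (preactivation k hk θ (feature φ θ x' k hk) i) - c|} ≤
      ENNReal.ofReal (V / (w (k + 1) * (ε / 2) ^ 2)) := by
  classical
  have hG : ∀ y y' : Fin (w 0) → ℝ, Measurable fun θ : Param w D → ℝ =>
      gram Cw Cb w k (feature φ θ y k hk) (feature φ θ y' k hk) := fun y y' =>
    measurable_empiricalKernel hφ Cw Cb k hk y y'
  have hS : Measurable fun θ : Param w D → ℝ =>
      gramMatrix Cw Cb k (feature φ θ x k hk) (feature φ θ x' k hk) := by
    refine measurable_matrix fun s t => ?_
    fin_cases s <;> fin_cases t <;> simpa [gramMatrix] using hG _ _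
  have hact : ∀ (y : Fin (w 0) → ℝ) i, Measurable fun θ : Param w D → ℝ =>
      φ (preactivation k hk θ (feature φ θ y k hk) i) := fun y i => by
    simp only [← activation_eq_preactivation]
    exact hφ.measurable.comp (measurable_activation hφ y k hk i)
  have havg : Measurable fun θ : Param w D → ℝ => |(w (k + 1) : ℝ)⁻¹ *
      ∑ i, φ (preactivation k hk θ (feature φ θ x k hk) i) *
        φ (preactivation k hk θ (feature φ θ x' k hk) i) - c| :=
    (((Finset.measurable_fun_sum _ fun i _ =>
      (hact x i).mul (hact x' i)).const_mul _).sub_const _).abs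
  refine paramMeasure_le_of_resample (layerParams w D k) ?_ fun η => ?_
  · exact (hS hU.measurableSet).inter (havg measurableSet_Ici)
  · simp only [Set.mem_ofPred_eq, feature_piecewise, preactivation_piecewise]
    by_cases hη : gramMatrix Cw Cb k (feature φ η x k hk) (feature φ η x' k hk) ∈ U
    · obtain ⟨h1, h2⟩ := h _ hη (posSemidef_gramMatrix k hk hw _ _)
      refine (measure_mono fun θ hθ => ?_).trans (measure_abs_average_sub_le Cw Cb k hk
        (feature φ η x k hk) (feature φ η x' k hk) hφ hlin hw h2 (half_pos hε))
      have hθ' := hθ.2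
      simp only [Set.mem_ofPred_eq]
      have := abs_sub_le ((w (k + 1) : ℝ)⁻¹ *
        ∑ i, φ (preactivation k hk θ (feature φ η x k hk) i) *
          φ (preactivation k hk θ (feature φ η x' k hk) i))
        (dualActivation φ (gramMatrix Cw Cb k (feature φ η x k hk) (feature φ η x' k hk))) c
      linarith
    · simp [hη]

/-- The covariance matrix of finitely many pre-nonlinearities given the layers below. -/
noncomputable def empiricalMatrix (φ : ℝ → ℝ) (Cw Cb : ℕ → ℝ≥0) (k : ℕ) (hk : k ≤ D) {κ : Type*}
    (i : κ → Fin (w (k + 1))) (x : κ → Fin (w 0) → ℝ) (θ : Param w D → ℝ) : Matrix κ κ ℝ :=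
  Matrix.of fun s t => if i s = i t then empiricalKernel φ Cw Cb k hk (x s) (x t) θ else 0

theorem posSemidef_empiricalMatrix (k : ℕ) (hk : k ≤ D) {κ : Type*} [Fintype κ]
    (i : κ → Fin (w (k + 1))) (x : κ → Fin (w 0) → ℝ) (θ : Param w D → ℝ) :
    (empiricalMatrix φ Cw Cb k hk i x θ).PosSemidef :=
  posSemidef_gram Cw Cb k i (fun s => feature φ θ (x s) k hk) hk

/-- Pre-nonlinearities are Gaussian given the layers below. -/
theorem charFun_activation (hφ : Continuous φ) (k : ℕ) (hk : k ≤ D) {κ : Type*} [Fintype κ]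
    (i : κ → Fin (w (k + 1))) (x : κ → Fin (w 0) → ℝ) (t : EuclideanSpace ℝ κ) :
    charFun ((paramMeasure Cw Cb w D).map fun θ =>
        (WithLp.toLp 2 fun s => activation φ θ (x s) k hk (i s) : EuclideanSpace ℝ κ)) t =
      ((∫ θ, Real.exp (-(t.ofLp ⬝ᵥ (empiricalMatrix φ Cw Cb k hk i x θ).mulVec t.ofLp) / 2)
        ∂(paramMeasure Cw Cb w D) : ℝ) : ℂ) := by
  classical
  have hact : Measurable fun θ : Param w D → ℝ =>
      (WithLp.toLp 2 fun s => activation φ θ (x s) k hk (i s) : EuclideanSpace ℝ κ) := by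
    refine (WithLp.measurable_toLp 2 _).comp (measurable_pi_lambda _ fun s => ?_)
    exact measurable_activation hφ _ k hk _
  set F : (Param w D → ℝ) → ℂ := fun θ => Complex.exp
    (inner ℝ (WithLp.toLp 2 fun s => activation φ θ (x s) k hk (i s)) t * Complex.I) with hF
  have hFm : Measurable F := by
    have : Continuous fun y : EuclideanSpace ℝ κ => Complex.exp (inner ℝ y t * Complex.I) := by
      fun_prop
    exact this.measurable.comp hact
  have hFn : ∀ θ, ‖F θ‖ ≤ 1 := fun θ => (Complex.norm_exp_ofReal_mul_I _).le
  have hmp := measurePreserving_piecewise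
    (fun p : Param w D => gaussianReal 0 (paramVar Cw Cb p)) (layerParams w D k)
  change MeasurePreserving _ ((paramMeasure Cw Cb w D).prod (paramMeasure Cw Cb w D))
    (paramMeasure Cw Cb w D) at hmp
  rw [charFun_apply, integral_map hact.aemeasurable (by fun_prop)]
  change ∫ θ, F θ ∂(paramMeasure Cw Cb w D) = _
  -- The parameters of layer `k` are redrawn; by Fubini the inner integral, with `η` frozen, is the
  -- characteristic function of an exact Gaussian.
  conv_lhs => rw [← hmp.map_eq]
  rw [integral_map hmp.measurable.aemeasurable hFm.aestronglyMeasurable, integral_prod]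
  · rw [← integral_complex_ofReal]
    refine integral_congr_ae (ae_of_all _ fun η => ?_)
    have hlaw := hasLaw_preactivation Cw Cb k hk i (fun s => feature φ η (x s) k hk)
    have hch := charFun_multivariateGaussian (μ := (0 : EuclideanSpace ℝ κ))
      (posSemidef_empiricalMatrix (Cw := Cw) (Cb := Cb) (φ := φ) k hk i x η) t
    rw [← show _ = multivariateGaussian 0 (empiricalMatrix φ Cw Cb k hk i x η) from hlaw.map_eq,
      charFun_apply, integral_map hlaw.aemeasurable (by fun_prop)] at hch
    simp only [hF, activation_eq_preactivation, feature_piecewise, preactivation_piecewise]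
    rw [hch]
    push_cast
    simp [neg_div]
  · exact Integrable.of_bound (hFm.comp hmp.measurable).aestronglyMeasurable 1
      (ae_of_all _ fun z => hFn _)

end Resampling

/-! ### Convergence of the empirical kernels and of the characteristic functions. -/

section Limit

variable {φ : ℝ → ℝ} {M L D : ℕ} {Cw Cb : ℕ → ℝ≥0} {h : ℕ → ℕ → ℕ}

theorem le_layerWidth (hh : ∀ μ, 1 ≤ μ → μ ≤ D → StrictMono (h μ)) {k : ℕ} (hk : k + 1 ≤ D)
    (n : ℕ) : n ≤ layerWidth M L D h n (k + 1) := by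
  simp only [layerWidth, if_pos (Nat.lt_of_succ_le hk)]
  exact (hh (k + 1) (by omega) hk).le_apply

/-- The empirical kernels converge in probability to the recursive kernels. -/
theorem tendsto_empiricalKernel (hφ : Continuous φ) (hlin : LinearEnvelope φ)
    (hh : ∀ μ, 1 ≤ μ → μ ≤ D → StrictMono (h μ)) (k : ℕ) (hk : k ≤ D) (x x' : Fin M → ℝ) :
    Tendsto (fun z : Σ n, Param (layerWidth M L D h n) D → ℝ =>
        empiricalKernel φ Cw Cb k hk x x' z.2)
      (inProbability fun n => paramMeasure Cw Cb (layerWidth M L D h n) D)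
      (𝓝 (kernel φ Cw Cb k x x')) := by
  induction k generalizing x x' with
  -- Layer 0 is the input itself, so the empirical kernel is deterministic and equals `kernel` by
  -- definition.
  | zero => exact tendsto_const_nhds
  | succ k ih =>
    have hk' : k ≤ D := Nat.le_of_succ_le hk
    set S₀ : Matrix (Fin 2) (Fin 2) ℝ := !![kernel φ Cw Cb k x x, kernel φ Cw Cb k x x';
      kernel φ Cw Cb k x' x, kernel φ Cw Cb k x' x'] with hS₀
    have hS : Tendsto (fun z : Σ n, Param (layerWidth M L D h n) D → ℝ =>
        gramMatrix Cw Cb k (feature φ z.2 x k hk') (feature φ z.2 x' k hk'))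
        (inProbability fun n => paramMeasure Cw Cb (layerWidth M L D h n) D) (𝓝 S₀) := by
      refine tendsto_pi_nhds.2 fun s => tendsto_pi_nhds.2 fun t => ?_
      fin_cases s <;> fin_cases t <;> simpa [gramMatrix, hS₀, empiricalKernel] using ih hk' _ _
    -- A hidden width may vanish at n = 0; for n > 0 it is at least n.
    have hpos : ∀ᶠ z : Σ n, Param (layerWidth M L D h n) D → ℝ in
        inProbability fun n => paramMeasure Cw Cb (layerWidth M L D h n) D,
        0 < layerWidth M L D h z.1 (k + 1) := by
      refine mem_inProbability.2 (tendsto_const_nhds.congr' ?_)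
      filter_upwards [eventually_gt_atTop 0] with n hn
      have := hn.trans_le (le_layerWidth (M := M) (L := L) hh hk n)
      simp [this.ne']
    -- Positive semidefiniteness of the kernel matrix is inherited from the Gram matrices that
    -- converge to it.
    have hS₀psd : S₀.PosSemidef := isClosed_posSemidef.mem_of_tendsto hS
      (hpos.mono fun z hz => posSemidef_gramMatrix k hk' hz _ _)
    have havg : Tendsto (fun z : Σ n, Param (layerWidth M L D h n) D → ℝ =>
        (layerWidth M L D h z.1 (k + 1) : ℝ)⁻¹ *
          ∑ i, φ (preactivation k hk' z.2 (feature φ z.2 x k hk') i) *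
            φ (preactivation k hk' z.2 (feature φ z.2 x' k hk') i))
        (inProbability fun n => paramMeasure Cw Cb (layerWidth M L D h n) D)
        (𝓝 (dualActivation φ S₀)) := by
      rw [Metric.tendsto_nhds]
      intro ε hε
      have h1 := (continuousOn_dualActivation hφ hlin S₀ hS₀psd).eventually
        (Metric.ball_mem_nhds _ (half_pos hε))
      have h2 := (continuousOn_dualActivationSq hφ hlin S₀ hS₀psd).eventually
        (gt_mem_nhds (lt_add_one _))
      -- `U` is a neighbourhood of S₀ on whose positive semidefinite matrices the conditional mean
      -- stays within ε/2 of its limit and the second moment stays below a constant independent of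
      -- n.
      obtain ⟨U, hUS, hUo, hU⟩ := mem_nhds_iff.1
        (eventually_nhdsWithin_iff.1 (h1.and h2))
      have hnear : {z : Σ n, Param (layerWidth M L D h n) D → ℝ |
          ¬ (gramMatrix Cw Cb k (feature φ z.2 x k hk') (feature φ z.2 x' k hk') ∈ U ∧
            ε ≤ |(layerWidth M L D h z.1 (k + 1) : ℝ)⁻¹ *
              ∑ i, φ (preactivation k hk' z.2 (feature φ z.2 x k hk') i) *
                φ (preactivation k hk' z.2 (feature φ z.2 x' k hk') i) -
              dualActivation φ S₀|)} ∈
          inProbability fun n => paramMeasure Cw Cb (layerWidth M L D h n) D := by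
        rw [mem_inProbability]
        have hlim : Tendsto (fun n => ENNReal.ofReal ((dualActivationSq φ S₀ + 1) /
            (layerWidth M L D h n (k + 1) * (ε / 2) ^ 2))) atTop (𝓝 0) := by
          rw [← ENNReal.ofReal_zero]
          refine ENNReal.tendsto_ofReal (Tendsto.const_div_atTop ?_ _)
          refine Tendsto.atTop_mul_const (by positivity) ?_
          exact tendsto_natCast_atTop_atTop.comp
            (tendsto_atTop_mono (fun n => le_layerWidth hh hk n) tendsto_id)
        refine tendsto_of_tendsto_of_tendsto_of_le_of_le' tendsto_const_nhds hlim
          (Eventually.of_forall fun _ => bot_le) ?_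
        filter_upwards [eventually_gt_atTop 0] with n hn
        simp only [not_not]
        refine measure_average_of_near_le hφ hlin k hk'
          (hn.trans_le (le_layerWidth hh hk n)) x x' hUo hε fun S hSU hSp => ?_
        have := hUS hSU hSp
        exact ⟨by simpa [Real.dist_eq] using this.1, this.2.le⟩
      filter_upwards [hS (hUo.mem_nhds hU), hnear] with z hz1 hz2
      rw [Real.dist_eq]
      by_contra hc
      exact hz2 ⟨hz1, not_lt.1 hc⟩
    have hfin := (havg.const_mul (Cw (k + 2) : ℝ)).add_const (Cb (k + 2) : ℝ)
    refine hfin.congr fun z => ?_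
    have hf : ∀ (y : Fin M → ℝ) i, feature φ z.2 y (k + 1) hk i =
        φ (preactivation k hk' z.2 (feature φ z.2 y k hk') i) := fun y i =>
      feature_succ (w := layerWidth M L D h z.1) z.2 y k hk i
    simp only [empiricalKernel, gram, hf, weightVar]
    push_cast
    ring

/-- The limiting covariance matrix of finitely many outputs. -/
noncomputable def limitMatrix (φ : ℝ → ℝ) (Cw Cb : ℕ → ℝ≥0) (D : ℕ) {κ : Type*}
    (i : κ → Fin L) (x : κ → Fin M → ℝ) : Matrix κ κ ℝ :=
  Matrix.of fun s t => if i s = i t then kernel φ Cw Cb D (x s) (x t) else 0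

/-- The outputs of a family of units at a family of inputs. -/
noncomputable def outputs (φ : ℝ → ℝ) {κ : Type*} (i : κ → Fin L) (x : κ → Fin M → ℝ) (n : ℕ)
    (θ : Param (layerWidth M L D h n) D → ℝ) (s : κ) : ℝ :=
  output φ θ (x s) (i s)

variable {κ : Type*} (i : κ → Fin L) (x : κ → Fin M → ℝ)

theorem measurable_outputs (hφ : Continuous φ) (n : ℕ) :
    Measurable (outputs (D := D) (h := h) φ i x n) :=
  measurable_pi_lambda _ fun _ => measurable_activation hφ _ _ _ _

theorem tendsto_empiricalMatrix (hφ : Continuous φ) (hlin : LinearEnvelope φ)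
    (hh : ∀ μ, 1 ≤ μ → μ ≤ D → StrictMono (h μ)) :
    Tendsto (fun z : Σ n, Param (layerWidth M L D h n) D → ℝ =>
        empiricalMatrix φ Cw Cb D le_rfl
          (fun s => Fin.cast (layerWidth_output M L D h z.1).symm (i s)) x z.2)
      (inProbability fun n => paramMeasure Cw Cb (layerWidth M L D h n) D)
      (𝓝 (limitMatrix φ Cw Cb D i x)) := by
  refine tendsto_pi_nhds.2 fun s => tendsto_pi_nhds.2 fun t => ?_
  by_cases hst : i s = i t
  · simpa [empiricalMatrix, limitMatrix, hst] using
      tendsto_empiricalKernel (L := L) hφ hlin hh D le_rfl (x s) (x t)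
  · simp [empiricalMatrix, limitMatrix, hst]

variable [Fintype κ]

theorem posSemidef_limitMatrix (hφ : Continuous φ) (hlin : LinearEnvelope φ)
    (hh : ∀ μ, 1 ≤ μ → μ ≤ D → StrictMono (h μ)) :
    (limitMatrix φ Cw Cb D i x).PosSemidef :=
  isClosed_posSemidef.mem_of_tendsto (tendsto_empiricalMatrix i x hφ hlin hh)
    (Eventually.of_forall fun z => posSemidef_empiricalMatrix (w := layerWidth M L D h z.1) D le_rfl
      (fun s => Fin.cast (layerWidth_output M L D h z.1).symm (i s)) x z.2)

/-- The integrand exp(-tᵀSt/2) is continuous in S and takes values in [0, 1] on positive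
semidefinite matrices, so convergence in probability of the empirical covariance gives convergence
of its expectation. -/
theorem tendsto_charFun_outputs [DecidableEq κ] (hφ : Continuous φ) (hlin : LinearEnvelope φ)
    (hh : ∀ μ, 1 ≤ μ → μ ≤ D → StrictMono (h μ)) (t : EuclideanSpace ℝ κ) :
    Tendsto (fun n => charFun ((paramMeasure Cw Cb (layerWidth M L D h n) D).map
        fun θ => (WithLp.toLp 2 (outputs φ i x n θ) : EuclideanSpace ℝ κ)) t) atTop
      (𝓝 (charFun (multivariateGaussian 0 (limitMatrix φ Cw Cb D i x)) t)) := by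
  have hlim := tendsto_empiricalMatrix (Cw := Cw) (Cb := Cb) i x hφ hlin hh
  have hpsd := posSemidef_limitMatrix (Cw := Cw) (Cb := Cb) i x hφ hlin hh
  have hexp : Continuous fun S : Matrix κ κ ℝ =>
      Real.exp (-(t.ofLp ⬝ᵥ S.mulVec t.ofLp) / 2) := by fun_prop
  have hrange : ∀ S : Matrix κ κ ℝ, S.PosSemidef →
      Real.exp (-(t.ofLp ⬝ᵥ S.mulVec t.ofLp) / 2) ∈ Set.Icc (0 : ℝ) 1 := fun S hS => by
    have := hS.dotProduct_mulVec_nonneg t.ofLp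
    simp only [star_trivial] at this
    exact ⟨(Real.exp_pos _).le, Real.exp_le_one_iff.2 (by linarith)⟩
  have hmeas : ∀ n, Measurable fun θ : Param (layerWidth M L D h n) D → ℝ =>
      empiricalMatrix φ Cw Cb D le_rfl
        (fun s => Fin.cast (layerWidth_output M L D h n).symm (i s)) x θ := fun n => by
    refine measurable_matrix fun s s' => ?_
    simp only [empiricalMatrix, Matrix.of_apply]
    split_ifs
    · exact measurable_empiricalKernel hφ Cw Cb D le_rfl _ _
    · exact measurable_const
  have hint := tendsto_integral_of_inProbability (C := 1) ((hexp.tendsto _).comp hlim)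
    (fun n => (hexp.measurable.comp (hmeas n)).aemeasurable) (fun z => by
      have h1 := hrange _ (posSemidef_empiricalMatrix (w := layerWidth M L D h z.1)
        (Cw := Cw) (Cb := Cb) (φ := φ) D le_rfl
        (fun s => Fin.cast (layerWidth_output M L D h z.1).symm (i s)) x z.2)
      have h2 := hrange _ hpsd
      simp only [Function.comp_apply]
      exact abs_sub_le_iff.2 ⟨by linarith [h1.2, h2.1], by linarith [h1.1, h2.2]⟩)
  have hc := (Complex.continuous_ofReal.tendsto _).comp hint
  convert hc using 1
  · ext n
    exact charFun_activation (w := layerWidth M L D h n) hφ D le_rfl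
      (fun s => Fin.cast (layerWidth_output M L D h n).symm (i s)) x t
  · rw [charFun_multivariateGaussian hpsd]
    push_cast
    simp [neg_div]

end Limit

/-! ### Gaussian processes read off from their finite marginals. -/

section GaussianProcess

/-- The centred Gaussian law with covariance matrix `S`, on functions with the product topology. -/
noncomputable def gaussianPi {κ : Type*} [Fintype κ] [DecidableEq κ] (S : Matrix κ κ ℝ) :
    ProbabilityMeasure (κ → ℝ) :=
  ⟨(multivariateGaussian 0 S).map (WithLp.ofLp (p := 2)),
    Measure.isProbabilityMeasure_map (WithLp.measurable_ofLp 2 _).aemeasurable⟩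

theorem isGaussian_gaussianPi {κ : Type*} [Fintype κ] [DecidableEq κ] (S : Matrix κ κ ℝ) :
    IsGaussian (gaussianPi S : Measure (κ → ℝ)) :=
  inferInstanceAs (IsGaussian ((multivariateGaussian 0 S).map
    (PiLp.continuousLinearEquiv 2 ℝ (fun _ : κ => ℝ))))

theorem integral_eval_gaussianPi {κ : Type*} [Fintype κ] [DecidableEq κ] (S : Matrix κ κ ℝ)
    (s : κ) : ∫ f, f s ∂(gaussianPi S : Measure (κ → ℝ)) = 0 := by
  change ∫ f, f s ∂((multivariateGaussian 0 S).map (WithLp.ofLp (p := 2))) = 0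
  refine (integral_map (f := fun f : κ → ℝ => f s) (WithLp.measurable_ofLp 2 _).aemeasurable
    (measurable_pi_apply s).aestronglyMeasurable).trans ?_
  have h := ContinuousLinearMap.integral_comp_id_comm
    (IsGaussian.integrable_id (μ := multivariateGaussian (0 : EuclideanSpace ℝ κ) S))
    (EuclideanSpace.proj s : EuclideanSpace ℝ κ →L[ℝ] ℝ)
  simpa using h

theorem covariance_eval_gaussianPi {κ : Type*} [Fintype κ] [DecidableEq κ] {S : Matrix κ κ ℝ}
    (hS : S.PosSemidef) (s t : κ) :
    cov[fun f => f s, fun f => f t; (gaussianPi S : Measure (κ → ℝ))] = S s t := by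
  change cov[fun f => f s, fun f => f t;
    (multivariateGaussian 0 S).map (WithLp.ofLp (p := 2))] = S s t
  rw [covariance_map (measurable_pi_apply s).aestronglyMeasurable
    (measurable_pi_apply t).aestronglyMeasurable (WithLp.measurable_ofLp 2 _).aemeasurable]
  exact covariance_eval_multivariateGaussian hS s t

variable {T : Type*} [DecidableEq T] {ν : Measure (T → ℝ)} {C : T → T → ℝ}

theorem isGaussianProcess_of_marginals
    (hν : ∀ I : Finset T, ν.map I.restrict = gaussianPi (Matrix.of fun s t : I => C s t)) :
    IsGaussianProcess (fun t (f : T → ℝ) => f t) ν where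
  hasGaussianLaw I := by
    refine ⟨?_⟩
    change IsGaussian (ν.map I.restrict)
    rw [hν I]
    exact isGaussian_gaussianPi _

theorem integral_eval_of_marginals
    (hν : ∀ I : Finset T, ν.map I.restrict = gaussianPi (Matrix.of fun s t : I => C s t))
    (t : T) : ∫ f, f t ∂ν = 0 := by
  have h := integral_eval_gaussianPi (Matrix.of fun s t : ({t} : Finset T) => C s t) ⟨t, by simp⟩
  rw [← hν] at h
  exact (integral_map (Finset.measurable_restrict (X := fun _ : T => ℝ) {t}).aemeasurable
    (measurable_pi_apply _).aestronglyMeasurable).symm.trans h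

/-- The marginal on {s, t} suffices, also when s = t. Positive semidefiniteness ensures that
`gaussianPi` has the matrix as its covariance. -/
theorem covariance_eval_of_marginals
    (hν : ∀ I : Finset T, ν.map I.restrict = gaussianPi (Matrix.of fun s t : I => C s t))
    (hC : ∀ I : Finset T, (Matrix.of fun s t : I => C s t).PosSemidef) (s t : T) :
    cov[fun f => f s, fun f => f t; ν] = C s t := by
  have h := covariance_eval_gaussianPi (hC {s, t}) ⟨s, by simp⟩ ⟨t, by simp⟩
  rw [← hν] at h
  exact (covariance_map (measurable_pi_apply _).aestronglyMeasurable
    (measurable_pi_apply _).aestronglyMeasurable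
    (Finset.measurable_restrict (X := fun _ : T => ℝ) {s, t}).aemeasurable).symm.trans h

end GaussianProcess

/-! ### Weak convergence of finitely many outputs. -/

section Marginals

variable {φ : ℝ → ℝ} {M L D : ℕ} {Cw Cb : ℕ → ℝ≥0} {h : ℕ → ℕ → ℕ}

/-- Weak convergence of finitely many outputs at finitely many inputs. -/
theorem tendsto_law_outputs (hφ : Continuous φ) (hlin : LinearEnvelope φ)
    (hh : ∀ μ, 1 ≤ μ → μ ≤ D → StrictMono (h μ)) {κ : Type*} [Fintype κ] [DecidableEq κ]
    (i : κ → Fin L) (x : κ → Fin M → ℝ) {m : ℕ → ProbabilityMeasure (κ → ℝ)}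
    (hm : ∀ n, (m n : Measure (κ → ℝ)) =
      (paramMeasure Cw Cb (layerWidth M L D h n) D).map (outputs φ i x n)) :
    Tendsto m atTop (𝓝 (gaussianPi (limitMatrix φ Cw Cb D i x))) := by
  -- Characteristic functions need an inner product, so Lévy's theorem is applied on
  -- `EuclideanSpace` and the limit is carried back along the continuous map `ofLp`.
  have hE : ∀ n, AEMeasurable (WithLp.toLp 2 : (κ → ℝ) → EuclideanSpace ℝ κ) (m n) :=
    fun n => (WithLp.measurable_toLp 2 _).aemeasurable
  have h1 : Tendsto (fun n => (m n).map (hE n)) atTop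
      (𝓝 ⟨multivariateGaussian 0 (limitMatrix φ Cw Cb D i x), inferInstance⟩) := by
    refine ProbabilityMeasure.tendsto_of_tendsto_charFun fun t => ?_
    refine (tendsto_charFun_outputs i x hφ hlin hh t).congr fun n => ?_
    rw [ProbabilityMeasure.toMeasure_map, hm, Measure.map_map (WithLp.measurable_toLp 2 _)
      (measurable_outputs i x hφ n)]
    rfl
  have h2 := ProbabilityMeasure.tendsto_map_of_tendsto_of_continuous _ _ h1
    (PiLp.continuous_ofLp 2 (fun _ : κ => ℝ))
  refine h2.congr fun n => Subtype.ext ?_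
  exact (Measure.map_map (WithLp.measurable_ofLp 2 (κ → ℝ))
    (WithLp.measurable_toLp 2 _)).trans Measure.map_id

theorem map_param_eq_paramMeasure {w : ℕ → ℕ} {Ω : Type*} [MeasurableSpace Ω] {P : Measure Ω}
    [IsProbabilityMeasure P] {θ : Param w D → Ω → ℝ} (hindep : iIndepFun θ P)
    (hlaw : ∀ p, HasLaw (θ p) (gaussianReal 0 (paramVar Cw Cb p)) P) :
    P.map (fun ω p => θ p ω) = paramMeasure Cw Cb w D := by
  rw [hindep.map_fun_eq_pi_map fun p => (hlaw p).aemeasurable, paramMeasure]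
  simp only [fun p => (hlaw p).map_eq]

end Marginals

end WideNet

/-! ### The main theorem. -/

theorem theorem1 (M L D : ℕ) (φ : ℝ → ℝ) (hφ : Continuous φ) (hlin : WideNet.LinearEnvelope φ)
    (Cw Cb : ℕ → ℝ≥0)
    (h : ℕ → ℕ → ℕ) (hh : ∀ μ, 1 ≤ μ → μ ≤ D → StrictMono (h μ))
    (x : ℕ → Fin M → ℝ)
    (Ω : ℕ → Type*) [∀ n, MeasurableSpace (Ω n)]
    (P : (n : ℕ) → Measure (Ω n)) [∀ n, IsProbabilityMeasure (P n)]
    (θ : (n : ℕ) → WideNet.Param (WideNet.layerWidth M L D h n) D → Ω n → ℝ)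
    (hindep : ∀ n, iIndepFun (θ n) (P n))
    (hlaw : ∀ n p, HasLaw (θ n p) (gaussianReal 0 (WideNet.paramVar Cw Cb p)) (P n)) :
    ∃ ν : ProbabilityMeasure (ℕ × Fin L → ℝ),
      IsGaussianProcess (fun (t : ℕ × Fin L) (f : ℕ × Fin L → ℝ) => f t)
        (ν : Measure (ℕ × Fin L → ℝ)) ∧
      (∀ t : ℕ × Fin L, ∫ f, f t ∂(ν : Measure (ℕ × Fin L → ℝ)) = 0) ∧
      (∀ s t : ℕ × Fin L,
        covariance (fun f => f s) (fun f => f t) (ν : Measure (ℕ × Fin L → ℝ)) =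
          if s.2 = t.2 then WideNet.kernel φ Cw Cb D (x s.1) (x t.1) else 0) ∧
      TendstoInDistribution
        (fun n ω (t : ℕ × Fin L) => WideNet.output φ (fun p => θ n p ω) (x t.1) t.2)
        atTop (fun f => f) P (ν : Measure (ℕ × Fin L → ℝ)) := by
  classical
  let T := ℕ × Fin L
  let C : T → T → ℝ := fun s t =>
    if s.2 = t.2 then WideNet.kernel φ Cw Cb D (x s.1) (x t.1) else 0
  have hout : ∀ n, Measurable (WideNet.outputs (D := D) (h := h) φ (fun t : T => t.2)
      (fun t : T => x t.1) n) := WideNet.measurable_outputs _ _ hφ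
  -- Convergence in distribution sees only laws, so the spaces `Ω n` are replaced by the canonical
  -- parameter space.
  let μ : ℕ → ProbabilityMeasure (T → ℝ) := fun n =>
    ⟨(WideNet.paramMeasure Cw Cb (WideNet.layerWidth M L D h n) D).map
      (WideNet.outputs φ (fun t : T => t.2) (fun t : T => x t.1) n),
      Measure.isProbabilityMeasure_map (hout n).aemeasurable⟩
  have hlim : ∀ I : Finset T, Tendsto (fun n => (μ n).map
      (Finset.measurable_restrict (X := fun _ : T => ℝ) I).aemeasurable) atTop
      (𝓝 (WideNet.gaussianPi (Matrix.of fun s t : I => C s t))) := fun I =>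
    WideNet.tendsto_law_outputs hφ hlin hh (fun s : I => s.1.2) (fun s : I => x s.1.1) fun n => by
      rw [ProbabilityMeasure.toMeasure_map]
      exact Measure.map_map (Finset.measurable_restrict I) (hout n)
  have hC : ∀ I : Finset T, (Matrix.of fun s t : I => C s t).PosSemidef := fun I =>
    WideNet.posSemidef_limitMatrix (fun s : I => s.1.2) (fun s : I => x s.1.1) hφ hlin hh
  obtain ⟨ν, hν, hμν⟩ := WideNet.exists_tendsto_of_tendsto_marginals μ _ hlim
  have hθ : ∀ n, AEMeasurable (fun ω p => θ n p ω) (P n) := fun n =>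
    aemeasurable_pi_lambda _ fun p => (hlaw n p).aemeasurable
  refine ⟨ν, WideNet.isGaussianProcess_of_marginals hν, WideNet.integral_eval_of_marginals hν,
    WideNet.covariance_eval_of_marginals hν hC, ?_⟩
  refine ⟨fun n => (hout n).comp_aemeasurable (hθ n), aemeasurable_id, ?_⟩
  have hν' : (⟨(ν : Measure (T → ℝ)).map fun f => f,
      Measure.isProbabilityMeasure_map aemeasurable_id⟩ : ProbabilityMeasure (T → ℝ)) = ν :=
    Subtype.ext Measure.map_id
  rw [hν']
  refine hμν.congr fun n => Subtype.ext ?_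
  change (WideNet.paramMeasure Cw Cb _ D).map _ =
    (P n).map (WideNet.outputs φ (fun t : T => t.2) (fun t : T => x t.1) n ∘ fun ω p => θ n p ω)
  rw [← AEMeasurable.map_map_of_aemeasurable (hout n).aemeasurable (hθ n),
    WideNet.map_param_eq_paramMeasure (hindep n) (hlaw n)]
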